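/- **Brewka's preferred subtheories as an ASPIC$^+$ instance.** *Default theories.* Let $\mathcal L$ be the set of formulas of a classical first-order language (free variables allowed), and let $Cn$ be classical consequence: $\varphi\in Cn(S)$ iff $\varphi$ is true in every nonempty structure under every assignment that makes all of $S$ true. A set $S$ is consistent iff $Cn(S)\neq\mathcal L$. A (stratified) default theory is a tuple $\Gamma=(\Gamma_1,\dots,\Gamma_n)$ of pairwise disjoint sets $\Gamma_i\subseteq\mathcal L$; we also write $\Gamma$ for their union. A preferred subtheory of $\Gamma$ is a set $\Sigma=\Sigma_1\cup\dots\cup\Sigma_n$ such that for every $i$, $\Sigma_1\cup\dots\cup\Sigma_i$ is a $\subseteq$-maximal consistent subset of $\Gamma_1\cup\dots\cup\Gamma_i$. Put $\alpha\le'\beta$ iff $\alpha\in\Gamma_i$, $\beta\in\Gamma_j$ with $i\ge j$, and $\alpha<'\beta$ iff $\alpha\le'\beta$ and $\beta\not\le'\alpha$. *Contrariness.* Let $\varphi\mapsto\overline\varphi\subseteq\mathcal L$ be any function such that: $\varphi\in\overline\psi$ implies $\psi\in\overline\varphi$; $\varphi\in\overline\psi$ implies that $\{\varphi,\psi\}$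 is inconsistent; if $\{\varphi,\psi\}$ is inconsistent then some $\varphi'\in Cn(\{\varphi\})$ lies in $\overline\psi$; every $\overline\varphi$ is nonempty. (Classical negation, $\psi\in\overline\varphi$ iff $\psi=\neg\varphi$ or $\varphi=\neg\psi$, is an example.) *The c-SAF $(\mathcal A,\mathcal C,\preceq)$ corresponding to $\Gamma$.* It is the ASPIC$^+$ c-structured argumentation framework with no axiom premises, ordinary premises $\Gamma$, no defeasible rules, and a strict rule $\varphi_1,\dots,\varphi_m\to p$ ($m\ge 0$) exactly when $p\in Cn(\{\varphi_1,\dots,\varphi_m\})$. Arguments are finite trees: each $\varphi\in\Gamma$ is an argument with premise set $\mathtt{Prem}=\{\varphi\}$ and conclusion $\mathtt{Conc}=\varphi$; if $A_1,\dots,A_m$ are arguments and $\mathtt{Conc}(A_1),\dots,\mathtt{Conc}(A_m)\to p$ is a strict rule, then $A_1,\dots,A_m\to p$ is an argument with $\mathtt{Prem}=\bigcup_k\mathtt{Prem}(A_k)$ and $\mathtt{Conc}=p$. $\mathcal A$ is the set of arguments $A$ for which no $\varphi,\psi$ with $\psi\in\overline\varphi$ are both conclusions of trees built by strict rules from premises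 in $\mathtt{Prem}(A)$. $X$ attacks $Y$ (on $\varphi$), i.e. $(X,Y)\in\mathcal C$, iff $\mathtt{Conc}(X)\in\overline\varphi$ for some $\varphi\in\mathtt{Prem}(Y)$. The ordering $\preceq$ is given by the weakest link or the last link principle with the elitist set comparison; since there are no defeasible rules, for both principles $X\prec Y$ iff $\mathtt{Prem}(X)\neq\emptyset$ and either $\mathtt{Prem}(Y)=\emptyset$ or some $x\in\mathtt{Prem}(X)$ satisfies $x<'y$ for all $y\in\mathtt{Prem}(Y)$; and $X\preceq Y$ iff $X\prec Y$ or $\mathtt{Prem}(X)=\mathtt{Prem}(Y)$. $X$ defeats $Y$ iff for some $\varphi$, $X$ attacks $Y$ on $\varphi$ and $X\not\prec\varphi$, where $\varphi$ denotes the argument consisting of that premise alone. *Extensions.* A set $E\subseteq\mathcal A$ is conflict free iff no member attacks a member. $X$ is acceptable w.r.t. $E$ iff every argument in $\mathcal A$ that defeats $X$ is defeated by a member of $E$. $E$ is complete iff it is conflict free, all its members are acceptable w.r.t. $E$, and it contains every argument of $\mathcal A$ acceptable w.r.t. $E$; $E$ is stable iff it is a $\subseteq$-maximal complete set and every argument in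 $\mathcal A\setminus E$ is defeated by a member of $E$. **Theorem.** Let $(\mathcal A,\mathcal C,\preceq)$ be the c-SAF corresponding to a default theory $\Gamma$, under the weakest or the last link principle with the elitist comparison. For $\Sigma\subseteq\Gamma$ let $\mathtt{Args}(\Sigma)=\{A\in\mathcal A : \mathtt{Prem}(A)\subseteq\Sigma\}$. Then: 1. if $\Sigma$ is a preferred subtheory of $\Gamma$, then $\mathtt{Args}(\Sigma)$ is a stable extension of $(\mathcal A,\mathcal C,\preceq)$; 2. if $E$ is a stable extension of $(\mathcal A,\mathcal C,\preceq)$, then $\bigcup_{A\in E}\mathtt{Prem}(A)$ is a preferred subtheory of $\Gamma$. -/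

import Mathlib

universe u v w

namespace ASPIC

/-! ### Rules, arguments and their components -/

/-- An inference rule `φ₁, …, φₙ → φ` or `φ₁, …, φₙ ⇒ φ`. Whether a rule is strict or defeasible is
decided by membership in the sets of strict and defeasible rules of an argumentation system. -/
structure Rule (F : Type u) where
  antecedents : List F
  consequent : F

/-- Finite inference trees: a single premise `φ`, the application `A₁, …, Aₙ → ψ` of a strict rule,
or the application `A₁, …, Aₙ ⇒ ψ` of a defeasible rule (`n = 0` is allowed). -/
inductive Argument (F : Type u) : Type u where
  | premise (φ : F) : Argument F
  | strict (n : ℕ) (A : Fin n → Argument F) (ψ : F) : Argument F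
  | defeasible (n : ℕ) (A : Fin n → Argument F) (ψ : F) : Argument F

namespace Argument

variable {F : Type u}

/-- `Conc(A)`. -/
def conc : Argument F → F
  | premise φ => φ
  | strict _ _ ψ => ψ
  | defeasible _ _ ψ => ψ

/-- `Prem(A)`. -/
def prem : Argument F → Set F
  | premise φ => {φ}
  | strict _ A _ => ⋃ i, (A i).prem
  | defeasible _ A _ => ⋃ i, (A i).prem

/-- `Sub(A)`. -/
def sub : Argument F → Set (Argument F)
  | premise φ => {premise φ}
  | strict n A ψ => (⋃ i, (A i).sub) ∪ {strict n A ψ}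
  | defeasible n A ψ => (⋃ i, (A i).sub) ∪ {defeasible n A ψ}

/-- The rule `Conc(A₁), …, Conc(Aₙ) → ψ` (or `⇒ ψ`) applied to arguments `A₁, …, Aₙ`. -/
def appliedRule {n : ℕ} (A : Fin n → Argument F) (ψ : F) : Rule F :=
  ⟨List.ofFn fun i => (A i).conc, ψ⟩

/-- `Rules(A)`. -/
def rules : Argument F → Set (Rule F)
  | premise _ => ∅
  | strict _ A ψ => (⋃ i, (A i).rules) ∪ {appliedRule A ψ}
  | defeasible _ A ψ => (⋃ i, (A i).rules) ∪ {appliedRule A ψ}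

/-- `TopRule(A)`, undefined (`none`) for a premise. -/
def topRule : Argument F → Option (Rule F)
  | premise _ => none
  | strict _ A ψ => some (appliedRule A ψ)
  | defeasible _ A ψ => some (appliedRule A ψ)

/-- `LastDefRules(A)`. An argument without defeasible rules gets `∅`, since then no branch
of the recursion ends in a defeasible rule. -/
def lastDefRules : Argument F → Set (Rule F)
  | premise _ => ∅
  | strict _ A _ => ⋃ i, (A i).lastDefRules
  | defeasible _ A ψ => {appliedRule A ψ}

end Argument

/-! ### Argumentation systems and knowledge bases -/

/-- An argumentation system over the language `F`; `contrary φ` is the set `φ̄`. -/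
structure ArgumentationSystem (F : Type u) where
  contrary : F → Set F
  exists_contradictory : ∀ φ, ∃ ψ, ψ ∈ contrary φ ∧ φ ∈ contrary ψ
  strictRules : Set (Rule F)
  defeasibleRules : Set (Rule F)
  disjoint_rules : Disjoint strictRules defeasibleRules
  name : defeasibleRules → F

/-- A knowledge base: disjoint sets of axioms `𝒦ₙ` and ordinary premises `𝒦ₚ`. -/
structure KnowledgeBase (F : Type u) where
  axioms : Set F
  ordinary : Set F
  disjoint_premises : Disjoint axioms ordinary

namespace ArgumentationSystem

variable {F : Type u} (AS : ArgumentationSystem F)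

/-- `φ` is a contrary of `ψ`. -/
def IsContrary (φ ψ : F) : Prop := φ ∈ AS.contrary ψ ∧ ψ ∉ AS.contrary φ

/-- `φ` is a contradictory of `ψ`, written `φ = -ψ`. -/
def IsContradictory (φ ψ : F) : Prop := φ ∈ AS.contrary ψ ∧ ψ ∈ AS.contrary φ

/-- `A` is an argument of the argumentation system, with premises from the set `P`. -/
def IsArgument (P : Set F) : Argument F → Prop
  | .premise φ => φ ∈ P
  | .strict _ A ψ => (∀ i, IsArgument P (A i)) ∧ Argument.appliedRule A ψ ∈ AS.strictRules
  | .defeasible _ A ψ => (∀ i, IsArgument P (A i)) ∧ Argument.appliedRule A ψ ∈ AS.defeasibleRules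

/-- `DefRules(A)`. -/
def defRules (A : Argument F) : Set (Rule F) := {r | r ∈ A.rules ∧ r ∈ AS.defeasibleRules}

/-- `A` is a strict argument. -/
def IsStrict (A : Argument F) : Prop := AS.defRules A = ∅

/-- `S ⊢ φ`: some strict argument with premises from `S` concludes `φ`. -/
def Derives (S : Set F) (φ : F) : Prop :=
  ∃ A : Argument F, AS.IsArgument S A ∧ AS.IsStrict A ∧ A.conc = φ

/-- `S` is c-consistent: for no `φ` and no contradictory `-φ` both `S ⊢ φ` and `S ⊢ -φ`. -/
def CConsistent (S : Set F) : Prop :=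
  ∀ φ ψ, AS.IsContradictory ψ φ → ¬ (AS.Derives S φ ∧ AS.Derives S ψ)

end ArgumentationSystem

/-! ### c-structured argumentation frameworks -/

/-- The data of a c-SAF: an argumentation theory (an argumentation system with a knowledge base)
and an argument ordering `⪯`, of which only the values on the arguments of the c-SAF are used. -/
structure CSAF (F : Type u) where
  system : ArgumentationSystem F
  kb : KnowledgeBase F
  le : Argument F → Argument F → Prop

namespace CSAF

variable {F : Type u} (Δ : CSAF F)

/-- The set `𝒜` of c-consistent arguments on the basis of the argumentation theory. -/
def args : Set (Argument F) :=
  {A | Δ.system.IsArgument (Δ.kb.axioms ∪ Δ.kb.ordinary) A ∧ Δ.system.CConsistent A.prem}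

/-- `X ≺ Y`, the strict counterpart of `⪯`. -/
def lt (X Y : Argument F) : Prop := Δ.le X Y ∧ ¬ Δ.le Y X

/-- `A` undercuts `B` on `B'`. -/
def UndercutsOn (A B B' : Argument F) : Prop :=
  B' ∈ B.sub ∧ ∃ r : Δ.system.defeasibleRules,
    B'.topRule = some r.1 ∧ A.conc ∈ Δ.system.contrary (Δ.system.name r)

/-- `A` rebuts `B` on `B'`. -/
def RebutsOn (A B B' : Argument F) : Prop :=
  B' ∈ B.sub ∧ ∃ n C φ, B' = Argument.defeasible n C φ ∧ A.conc ∈ Δ.system.contrary φ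

/-- `A` contrary-rebuts `B` on `B'`. -/
def ContraryRebutsOn (A B B' : Argument F) : Prop :=
  B' ∈ B.sub ∧ ∃ n C φ, B' = Argument.defeasible n C φ ∧ Δ.system.IsContrary A.conc φ

/-- `A` undermines `B` on `B'`. -/
def UnderminesOn (A B B' : Argument F) : Prop :=
  ∃ φ, B' = Argument.premise φ ∧ φ ∈ B.prem ∩ Δ.kb.ordinary ∧ A.conc ∈ Δ.system.contrary φ

/-- `A` contrary-undermines `B` on `B'`. -/
def ContraryUnderminesOn (A B B' : Argument F) : Prop :=
  ∃ φ, B' = Argument.premise φ ∧ φ ∈ B.prem ∩ Δ.kb.ordinary ∧ Δ.system.IsContrary A.conc φ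

/-- `A` attacks `B` on `B'`. -/
def AttacksOn (A B B' : Argument F) : Prop :=
  Δ.UndercutsOn A B B' ∨ Δ.RebutsOn A B B' ∨ Δ.UnderminesOn A B B'

/-- `A` attacks `B`. -/
def Attacks (A B : Argument F) : Prop := ∃ B', Δ.AttacksOn A B B'

/-- `A` preference-independent attacks `B` on `B'`. -/
def PrefIndependentAttacksOn (A B B' : Argument F) : Prop :=
  Δ.UndercutsOn A B B' ∨ Δ.ContraryRebutsOn A B B' ∨ Δ.ContraryUnderminesOn A B B'

/-- `A` preference-dependent attacks `B` on `B'`. -/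
def PrefDependentAttacksOn (A B B' : Argument F) : Prop :=
  Δ.AttacksOn A B B' ∧ ¬ Δ.PrefIndependentAttacksOn A B B'

/-- `A` defeats `B`. -/
def Defeats (A B : Argument F) : Prop :=
  ∃ B', Δ.PrefIndependentAttacksOn A B B' ∨ (Δ.PrefDependentAttacksOn A B B' ∧ ¬ Δ.lt A B')

/-! Extensions: conflict-freeness is with respect to attacks, acceptability with respect to
defeats. -/

/-- `S ⊆ 𝒜` is (attack) conflict free. -/
def ConflictFree (S : Set (Argument F)) : Prop :=
  S ⊆ Δ.args ∧ ∀ X ∈ S, ∀ Y ∈ S, ¬ Δ.Attacks X Y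

/-- `X` is acceptable with respect to `S`. -/
def Acceptable (S : Set (Argument F)) (X : Argument F) : Prop :=
  ∀ Y ∈ Δ.args, Δ.Defeats Y X → ∃ Z ∈ S, Δ.Defeats Z Y

def IsAdmissible (S : Set (Argument F)) : Prop :=
  Δ.ConflictFree S ∧ ∀ X ∈ S, Δ.Acceptable S X

def IsComplete (S : Set (Argument F)) : Prop :=
  Δ.IsAdmissible S ∧ ∀ X ∈ Δ.args, Δ.Acceptable S X → X ∈ S

/-- A preferred extension: a set-inclusion maximal complete extension. -/
def IsPreferred (S : Set (Argument F)) : Prop := Maximal Δ.IsComplete S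

/-- A stable extension: a preferred extension that defeats every argument outside it. -/
def IsStable (S : Set (Argument F)) : Prop :=
  Δ.IsPreferred S ∧ ∀ Y ∈ Δ.args, Y ∉ S → ∃ X ∈ S, Δ.Defeats X Y

/-- `Args(S)`: all arguments in `𝒜` with premises taken from `S`. -/
def argsOver (S : Set F) : Set (Argument F) := {A | A ∈ Δ.args ∧ A.prem ⊆ S}

end CSAF

/-! ### The weakest and last link principles -/

/-- The elitist comparison `S ◁_Eli T` induced by `≤` (with `x < y` iff `x ≤ y` and not `y ≤ x`). -/
def EliLT {X : Type u} (le : X → X → Prop) (S T : Set X) : Prop :=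
  S ≠ ∅ ∧ (T = ∅ ∨ ∃ x ∈ S, ∀ y ∈ T, le x y ∧ ¬ le y x)

section Link

variable {F : Type u} (AS : ArgumentationSystem F) (K : KnowledgeBase F)
  (leRule : Rule F → Rule F → Prop) (lePrem : F → F → Prop)

/-- `Premₚ(A)`. -/
def ordinaryPrem (A : Argument F) : Set F := A.prem ∩ K.ordinary

/-- `A` is firm. -/
def IsFirm (A : Argument F) : Prop := A.prem ⊆ K.axioms

/-- `B ≺ A` under the last link principle. -/
def LastLinkLT (B A : Argument F) : Prop :=
  EliLT leRule B.lastDefRules A.lastDefRules ∨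
    (B.lastDefRules = ∅ ∧ A.lastDefRules = ∅ ∧
      EliLT lePrem (ordinaryPrem K B) (ordinaryPrem K A))

open Classical in
/-- `B ⪯ A` under the last link principle. -/
def LastLinkLE (B A : Argument F) : Prop :=
  LastLinkLT K leRule lePrem B A ∨
    if A.lastDefRules ≠ ∅ then A.lastDefRules = B.lastDefRules
    else ordinaryPrem K A = ordinaryPrem K B

open Classical in
/-- `B ≺ A` under the weakest link principle. -/
def WeakestLinkLT (B A : Argument F) : Prop :=
  if AS.IsStrict B ∧ AS.IsStrict A then EliLT lePrem (ordinaryPrem K B) (ordinaryPrem K A)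
  else if IsFirm K B ∧ IsFirm K A then EliLT leRule (AS.defRules B) (AS.defRules A)
  else EliLT lePrem (ordinaryPrem K B) (ordinaryPrem K A) ∧
    EliLT leRule (AS.defRules B) (AS.defRules A)

/-- `B ⪯ A` under the weakest link principle. -/
def WeakestLinkLE (B A : Argument F) : Prop :=
  WeakestLinkLT AS K leRule lePrem B A ∨
    (AS.defRules A = AS.defRules B ∧ ordinaryPrem K A = ordinaryPrem K B)

end Link

/-- The two principles for lifting preorderings to arguments. -/
inductive LinkPrinciple where
  | weakest
  | last

/-- The argument ordering `⪯` given by a link principle, with the elitist comparison. -/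
def LinkPrinciple.le {F : Type u} (AS : ArgumentationSystem F) (K : KnowledgeBase F)
    (leRule : Rule F → Rule F → Prop) (lePrem : F → F → Prop) :
    LinkPrinciple → Argument F → Argument F → Prop
  | .weakest => WeakestLinkLE AS K leRule lePrem
  | .last => LastLinkLE K leRule lePrem

/-! ### Argumentation theories based on a consequence operator -/

section Logic

variable {F : Type u}

/-- `S` is consistent for the consequence operator `Cn`. -/
def Consistent (Cn : Set F → Set F) (S : Set F) : Prop := Cn S ≠ Set.univ

/-- The conditions relating the contrariness function `φ ↦ φ̄` to the consequence operator. -/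
structure IsContrariness (Cn : Set F → Set F) (contrary : F → Set F) : Prop where
  symm : ∀ φ ψ, φ ∈ contrary ψ → ψ ∈ contrary φ
  inconsistent : ∀ φ ψ, φ ∈ contrary ψ → ¬ Consistent Cn {φ, ψ}
  exists_of_inconsistent : ∀ φ ψ, ¬ Consistent Cn {φ, ψ} → ∃ φ' ∈ Cn {φ}, φ' ∈ contrary ψ
  nonempty : ∀ φ, (contrary φ).Nonempty

/-- The argumentation system based on `Cn`: no defeasible rules, and `S → p` is a strict rule iff
`p ∈ Cn(S)`, for finite `S`. A list of antecedents stands for the finite set of its members. -/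
def logicSystem (Cn : Set F → Set F) (contrary : F → Set F) (h : IsContrariness Cn contrary) :
    ArgumentationSystem F where
  contrary := contrary
  exists_contradictory φ := (h.nonempty φ).imp fun _ hψ => ⟨hψ, h.symm _ _ hψ⟩
  strictRules := {r | r.consequent ∈ Cn {φ | φ ∈ r.antecedents}}
  defeasibleRules := ∅
  disjoint_rules := disjoint_bot_right
  name r := False.elim r.2

/-- The knowledge base without axioms whose ordinary premises are the members of `S`. -/
def ordinaryBase (S : Set F) : KnowledgeBase F where
  axioms := ∅
  ordinary := S
  disjoint_premises := disjoint_bot_left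

/-- The c-SAF based on `Cn`, a theory `S` with ordering `lePrem`, and a link principle. There are no
defeasible rules, so the preordering on them is the one on the empty set (given by equality). -/
def logicCSAF (Cn : Set F → Set F) (contrary : F → Set F) (h : IsContrariness Cn contrary)
    (S : Set F) (lePrem : F → F → Prop) (link : LinkPrinciple) : CSAF F where
  system := logicSystem Cn contrary h
  kb := ordinaryBase S
  le := link.le (logicSystem Cn contrary h) (ordinaryBase S) Eq lePrem

end Logic

/-! ### Classical first-order logic and default theories -/

section Classical

variable {L : FirstOrder.Language.{u, v}} {V : Type w}

/-- Classical first-order consequence for formulas with free variables in `V`: truth in every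
nonempty structure under every assignment is preserved. -/
def classicalCn (S : Set (L.Formula V)) : Set (L.Formula V) :=
  {φ | ∀ (M : Type (max u v w)) [L.Structure M] [Nonempty M] (a : V → M),
    (∀ ψ ∈ S, ψ.Realize a) → φ.Realize a}

/-- Classical negation as a (symmetric) contrariness function. -/
def classicalNegation (φ : L.Formula V) : Set (L.Formula V) := {ψ | ψ = φ.not ∨ φ = ψ.not}

theorem isContrariness_classicalNegation :
    IsContrariness (classicalCn (L := L) (V := V)) classicalNegation where
  symm _ _ h := h.symm
  inconsistent φ ψ h := by
    refine not_not.2 (Set.eq_univ_of_forall fun χ M _ _ a ha => ?_)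
    have h1 := ha φ (by simp)
    have h2 := ha ψ (by simp)
    rcases h with rfl | rfl
    · exact absurd h2 (FirstOrder.Language.Formula.realize_not.1 h1)
    · exact absurd h1 (FirstOrder.Language.Formula.realize_not.1 h2)
  exists_of_inconsistent φ ψ h := by
    refine ⟨ψ.not, fun M _ _ a ha => ?_, Or.inl rfl⟩
    rw [FirstOrder.Language.Formula.realize_not]
    intro h2
    have h3 : (⊥ : L.Formula V) ∈ classicalCn {φ, ψ} := by
      rw [not_not.1 h]
      trivial
    refine h3 M a ?_
    rintro χ (rfl | rfl)
    · exact ha _ rfl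
    · exact h2
  nonempty φ := ⟨φ.not, Or.inl rfl⟩

/-- A (stratified) default theory `(Γ₁, …, Γₙ)`: pairwise disjoint sets of first-order formulas. -/
structure DefaultTheory (L : FirstOrder.Language.{u, v}) (V : Type w) (n : ℕ) where
  stratum : Fin n → Set (L.Formula V)
  disjoint_strata : ∀ i j, i ≠ j → Disjoint (stratum i) (stratum j)

namespace DefaultTheory

variable {n : ℕ} (Γ : DefaultTheory L V n)

/-- All formulas of the default theory. -/
def formulas : Set (L.Formula V) := ⋃ i, Γ.stratum i

/-- `α ≤' β` iff `α ∈ Γᵢ` and `β ∈ Γⱼ` with `i ≥ j`: earlier strata are preferred. -/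
def le (α β : L.Formula V) : Prop := ∃ i j, α ∈ Γ.stratum i ∧ β ∈ Γ.stratum j ∧ i ≥ j

/-- `S = S₁ ∪ … ∪ Sₙ` is a preferred subtheory: for every `i`, `S₁ ∪ … ∪ Sᵢ` is a maximal consistent
subset of `Γ₁ ∪ … ∪ Γᵢ`. -/
def IsPreferredSubtheory (S : Set (L.Formula V)) : Prop :=
  ∃ P : Fin n → Set (L.Formula V), S = ⋃ i, P i ∧
    ∀ i, Maximal (fun T => T ⊆ (⋃ j ≤ i, Γ.stratum j) ∧ Consistent classicalCn T) (⋃ j ≤ i, P j)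

/-- The c-SAF corresponding to the default theory, under the weakest or last link principle. -/
def csaf (contrary : L.Formula V → Set (L.Formula V))
    (h : IsContrariness classicalCn contrary) (link : LinkPrinciple) : CSAF (L.Formula V) :=
  logicCSAF classicalCn contrary h Γ.formulas Γ.le link

end DefaultTheory

end Classical

end ASPIC

namespace ASPIC

open Set

/-! ### Classical consequence and compactness -/

section Classical

variable {L : FirstOrder.Language.{u, v}} {V : Type w}

/-! Without defeasible rules, all attacks are underminings; since contrariness is symmetric, none of
them is preference-independent. Both link principles compare premise sets only, so defeat becomes a
condition on strata (`csaf_defeats_iff`): `X` defeats `Y` on a premise `φ` of stratum `i` iff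
`Conc(X)` is in the contrariness set of `φ` and all premises of `X` lie in strata up to `i`.

Preferred subtheory to stable extension: consistency excludes internal attacks. If an argument uses
a default `φ` of stratum `i` outside the subtheory, maximality at level `i` makes `φ` inconsistent
with the part of the subtheory up to `i`. Compactness (`consistent_of_finset`) and one strict rule
turn this into an argument that attacks `φ` from strata up to `i`, hence defeats. A conflict-free
set defeating all outsiders is stable (`ConflictFree.isStable`).

Stable extension to preferred subtheory: in a minimal inconsistent set of its premises, the formulas
other than a least preferred one yield a defeater of the extension; the counter-defeat then hits
another premise of the extension, a conflict. This gives consistency and uses only admissibility.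
Maximality comes from the defeat of the one-premise argument of each omitted default. -/

theorem mem_classicalCn_of_mem {S : Set (L.Formula V)} {φ : L.Formula V} (h : φ ∈ S) :
    φ ∈ classicalCn S :=
  fun _ _ _ _ ha => ha φ h

theorem classicalCn_trans {S T : Set (L.Formula V)} (h : T ⊆ classicalCn S) :
    classicalCn T ⊆ classicalCn S :=
  fun _ hφ M _ _ a ha => hφ M a fun _ hψ => h hψ M a ha

theorem classicalCn_mono {S T : Set (L.Formula V)} (h : T ⊆ S) :
    classicalCn T ⊆ classicalCn S :=
  classicalCn_trans fun _ hφ => mem_classicalCn_of_mem (h hφ)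

theorem consistent_iff_bot_notMem {S : Set (L.Formula V)} :
    Consistent classicalCn S ↔ (⊥ : L.Formula V) ∉ classicalCn S := by
  refine ⟨fun h hbot => h (eq_univ_of_forall fun φ M _ _ a ha => (hbot M a ha).elim),
    fun h hS => h (hS ▸ mem_univ _)⟩

theorem consistent_iff_exists_model {S : Set (L.Formula V)} :
    Consistent classicalCn S ↔
      ∃ (M : Type (max u v w)) (_ : L.Structure M) (_ : Nonempty M) (a : V → M),
        ∀ ψ ∈ S, ψ.Realize a := by
  rw [consistent_iff_bot_notMem]
  constructor
  · intro h
    by_contra hM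
    exact h fun M i1 i2 a ha => (hM ⟨M, i1, i2, a, ha⟩).elim
  · rintro ⟨M, i1, i2, a, ha⟩ h
    exact h M a ha

theorem Consistent.of_subset_classicalCn {S T : Set (L.Formula V)}
    (hS : Consistent classicalCn S) (h : T ⊆ classicalCn S) : Consistent classicalCn T := by
  rw [consistent_iff_bot_notMem] at *
  exact fun hbot => hS (classicalCn_trans h hbot)

theorem Consistent.mono {S T : Set (L.Formula V)}
    (hS : Consistent classicalCn S) (h : T ⊆ S) : Consistent classicalCn T :=
  hS.of_subset_classicalCn fun _ hφ => mem_classicalCn_of_mem (h hφ)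

theorem consistent_empty : Consistent classicalCn (∅ : Set (L.Formula V)) := by
  -- A one-point structure interprets every language.
  let _ : L.Structure PUnit.{max u v w + 1} := ⟨fun _ _ => PUnit.unit, fun _ _ => False⟩
  exact consistent_iff_exists_model.2 ⟨PUnit, inferInstance, inferInstance, fun _ => PUnit.unit,
    fun ψ hψ => hψ.elim⟩

/-- Compactness for sets of formulas with free variables. -/
theorem consistent_of_finset {S : Set (L.Formula V)}
    (h : ∀ T : Finset (L.Formula V), ↑T ⊆ S → Consistent classicalCn (T : Set (L.Formula V))) :
    Consistent classicalCn S := by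
  have h' : ∀ T : Finset S, ∃ (M : Type (max u v w)) (_ : L.Structure M) (_ : Nonempty M)
      (a : V → M), ∀ ψ ∈ T, ψ.1.Realize a := by
    intro T
    obtain ⟨M, i1, i2, a, ha⟩ := consistent_iff_exists_model.1
      (h (T.map (Function.Embedding.subtype _)) (by simp))
    exact ⟨M, i1, i2, a, fun ψ hψ => ha ψ (by simpa using hψ)⟩
  choose M i1 i2 a ha using h'
  -- Each `ψ ∈ S` belongs to all `T` from `{ψ}` on, so an ultrafilter finer than `atTop` makes `ψ`
  -- true in the ultraproduct by Łoś, under the coordinatewise assignment.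
  let U : Ultrafilter (Finset S) := Ultrafilter.of Filter.atTop
  refine consistent_iff_exists_model.2 ⟨(U : Filter (Finset S)).Product M, inferInstance,
    inferInstance, fun x => (fun T => a T x : ∀ T, M T), fun ψ hψ => ?_⟩
  refine (FirstOrder.Language.Ultraproduct.realize_formula_cast ψ fun x T => a T x).2 ?_
  refine Ultrafilter.of_le Filter.atTop ?_
  filter_upwards [Filter.eventually_ge_atTop ({⟨ψ, hψ⟩} : Finset S)] with T hT
  exact ha T ⟨ψ, hψ⟩ (hT (Finset.mem_singleton_self _))

/-- A finite set that is inconsistent with `φ` entails some member of the contrariness set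
of `φ`. -/
theorem IsContrariness.exists_mem_classicalCn {contrary : L.Formula V → Set (L.Formula V)}
    (h : IsContrariness classicalCn contrary) {T : Finset (L.Formula V)} {φ : L.Formula V}
    (hT : ¬ Consistent classicalCn (insert φ (T : Set (L.Formula V)))) :
    ∃ ψ ∈ classicalCn (T : Set (L.Formula V)), ψ ∈ contrary φ := by
  -- The contrariness axiom speaks of pairs of formulas, so `T` is replaced by its conjunction,
  -- which is `⊤` for empty `T`.
  let χ : L.Formula V := T.toList.foldr (· ⊓ ·) ⊤
  have hχ : ∀ (M : Type (max u v w)) [L.Structure M] (a : V → M),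
      χ.Realize a ↔ ∀ ψ ∈ T, ψ.Realize a := by
    intro M _ a
    refine (FirstOrder.Language.BoundedFormula.realize_foldr_inf T.toList a _).trans ?_
    simp only [Finset.mem_toList]
    rfl
  obtain ⟨ψ, hψ, hψφ⟩ := h.exists_of_inconsistent χ φ fun hc => hT <| by
    refine hc.of_subset_classicalCn ?_
    rintro θ (rfl | hθ) M _ _ a ha
    · exact ha θ (by simp)
    · exact (hχ M a).1 (ha χ (by simp)) θ hθ
  refine ⟨ψ, classicalCn_trans ?_ hψ, hψφ⟩
  rintro _ rfl M _ _ a ha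
  exact (hχ M a).2 ha

end Classical

/-! ### Argumentation frameworks -/

namespace CSAF

variable {F : Type u} {Δ : CSAF F}

theorem Defeats.attacks {X Y : Argument F} (h : Δ.Defeats X Y) : Δ.Attacks X Y := by
  obtain ⟨B, (h | ⟨hB, n, C, φ, h⟩ | ⟨φ, h⟩) | h⟩ := h
  · exact ⟨B, Or.inl h⟩
  · exact ⟨B, Or.inr (Or.inl ⟨hB, n, C, φ, h.1, h.2.1⟩)⟩
  · exact ⟨B, Or.inr (Or.inr ⟨φ, h.1, h.2.1, h.2.2.1⟩)⟩
  · exact ⟨B, h.1.1⟩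

/-- A conflict-free set that defeats every argument outside it is a stable extension. -/
theorem ConflictFree.isStable {E : Set (Argument F)} (hE : Δ.ConflictFree E)
    (hdef : ∀ Y ∈ Δ.args, Y ∉ E → ∃ X ∈ E, Δ.Defeats X Y) : Δ.IsStable E := by
  refine ⟨⟨⟨⟨hE, fun X hX Y hY hYX => hdef Y hY fun hYE => ?_⟩, fun X hX hacc => ?_⟩,
    fun E' hE' hsub X hX => ?_⟩, hdef⟩
  · exact hE.2 Y hYE X hX hYX.attacks
  -- An acceptable outsider would force a member of `E` to defeat the member of `E` that defeats it.
  · by_contra hXE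
    obtain ⟨Z, hZ, hZX⟩ := hdef X hX hXE
    obtain ⟨W, hW, hWZ⟩ := hacc Z (hE.1 hZ) hZX
    exact hE.2 W hW Z hZ hWZ.attacks
  · by_contra hXE
    obtain ⟨Z, hZ, hZX⟩ := hdef X (hE'.1.1.1 hX) hXE
    exact hE'.1.1.2 Z (hsub hZ) X hX hZX.attacks

end CSAF

/-! ### Arguments of systems without defeasible rules -/

section Logic

variable {F : Type u} {Cn : Set F → Set F} {contrary : F → Set F}
  {h : IsContrariness Cn contrary} {P : Set F}

theorem prem_subset_of_isArgument {AS : ArgumentationSystem F} {A : Argument F}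
    (hA : AS.IsArgument P A) : A.prem ⊆ P := by
  induction A with
  | premise φ => exact singleton_subset_iff.2 hA
  | strict n A ψ ih => exact iUnion_subset fun i => ih i (hA.1 i)
  | defeasible n A ψ ih => exact iUnion_subset fun i => ih i (hA.1 i)

theorem isStrict_logicSystem (A : Argument F) : (logicSystem Cn contrary h).IsStrict A :=
  eq_empty_of_forall_notMem fun _ hr => hr.2

theorem lastDefRules_eq_empty {A : Argument F}
    (hA : (logicSystem Cn contrary h).IsArgument P A) : A.lastDefRules = ∅ := by
  induction A with
  | premise φ => rfl
  | strict n A ψ ih => exact iUnion_eq_empty.2 fun i => ih i (hA.1 i)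
  | defeasible n A ψ ih => exact hA.2.elim

theorem defeasible_notMem_sub {A : Argument F}
    (hA : (logicSystem Cn contrary h).IsArgument P A) {n : ℕ} {C : Fin n → Argument F} {φ : F} :
    Argument.defeasible n C φ ∉ A.sub := by
  induction A with
  | premise ψ => simp [Argument.sub]
  | strict m A ψ ih => simpa [Argument.sub] using fun i => ih i (hA.1 i)
  | defeasible m A ψ ih => exact hA.2.elim

theorem ordinaryPrem_ordinaryBase {AS : ArgumentationSystem F} {A : Argument F}
    (hA : AS.IsArgument P A) : ordinaryPrem (ordinaryBase P) A = A.prem :=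
  inter_eq_left.2 (prem_subset_of_isArgument hA)

/-! ### The elitist ordering, attack and defeat -/

theorem linkPrinciple_le_iff {lePrem : F → F → Prop} {link : LinkPrinciple} {X Y : Argument F}
    (hX : (logicSystem Cn contrary h).IsArgument P X)
    (hY : (logicSystem Cn contrary h).IsArgument P Y) :
    link.le (logicSystem Cn contrary h) (ordinaryBase P) Eq lePrem X Y ↔
      EliLT lePrem X.prem Y.prem ∨ Y.prem = X.prem := by
  cases link with
  | weakest =>
    have hd : (logicSystem Cn contrary h).defRules X = ∅ := isStrict_logicSystem X
    have hd' : (logicSystem Cn contrary h).defRules Y = ∅ := isStrict_logicSystem Y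
    simp [LinkPrinciple.le, WeakestLinkLE, WeakestLinkLT, isStrict_logicSystem, hd, hd',
      ordinaryPrem_ordinaryBase hX, ordinaryPrem_ordinaryBase hY]
  | last =>
    -- `EliLT` is unfolded because its clause `S ≠ ∅` refutes the comparison of the two empty sets
    -- of last rules.
    simp [LinkPrinciple.le, LastLinkLE, LastLinkLT, lastDefRules_eq_empty hX,
      lastDefRules_eq_empty hY, ordinaryPrem_ordinaryBase hX, ordinaryPrem_ordinaryBase hY, EliLT]

/-- Witnesses for both comparisons would each be strictly below the other; no transitivity of `le`
is needed. Asymmetry and the resulting irreflexivity identify the strict part of `⪯` with `EliLT`.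
-/
theorem EliLT.asymm {X : Type u} {le : X → X → Prop} {S T : Set X} (h : EliLT le S T) :
    ¬ EliLT le T S := by
  rintro ⟨hT, hS | ⟨y, hy, hyS⟩⟩
  · exact h.1 hS
  · obtain hT' | ⟨x, hx, hxT⟩ := h.2
    · exact hT hT'
    · exact (hxT y hy).2 (hyS x hx).1

theorem logicCSAF_lt_iff {lePrem : F → F → Prop} {link : LinkPrinciple} {X Y : Argument F}
    (hX : (logicSystem Cn contrary h).IsArgument P X)
    (hY : (logicSystem Cn contrary h).IsArgument P Y) :
    (logicCSAF Cn contrary h P lePrem link).lt X Y ↔ EliLT lePrem X.prem Y.prem := by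
  have h1 := linkPrinciple_le_iff (lePrem := lePrem) (link := link) hX hY
  have h2 := linkPrinciple_le_iff (lePrem := lePrem) (link := link) hY hX
  unfold CSAF.lt
  refine (and_congr h1 (not_congr h2)).trans ?_
  constructor
  · rintro ⟨h | h, h'⟩
    · exact h
    · exact (h' (Or.inr h.symm)).elim
  · refine fun hlt => ⟨Or.inl hlt, ?_⟩
    rintro (h' | h')
    · exact hlt.asymm h'
    · rw [h'] at hlt
      exact hlt.asymm hlt

theorem isArgument_of_mem_args {lePrem : F → F → Prop} {link : LinkPrinciple} {X : Argument F}
    (hX : X ∈ (logicCSAF Cn contrary h P lePrem link).args) :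
    (logicSystem Cn contrary h).IsArgument P X := by
  have := hX.1
  rwa [show (logicCSAF Cn contrary h P lePrem link).kb.axioms ∪
    (logicCSAF Cn contrary h P lePrem link).kb.ordinary = P from empty_union P] at this

theorem logicCSAF_attacks_iff {lePrem : F → F → Prop} {link : LinkPrinciple} {X Y : Argument F}
    (hY : (logicSystem Cn contrary h).IsArgument P Y) :
    (logicCSAF Cn contrary h P lePrem link).Attacks X Y ↔
      ∃ φ ∈ Y.prem, X.conc ∈ contrary φ := by
  constructor
  · rintro ⟨B, ⟨_, r, _⟩ | ⟨hB, n, C, φ, rfl, _⟩ | ⟨φ, _, hφ, hc⟩⟩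
    · exact r.2.elim
    · exact (defeasible_notMem_sub hY hB).elim
    · exact ⟨φ, hφ.1, hc⟩
  · rintro ⟨φ, hφ, hc⟩
    exact ⟨_, Or.inr (Or.inr ⟨φ, rfl, ⟨hφ, prem_subset_of_isArgument hY hφ⟩, hc⟩)⟩

theorem logicCSAF_defeats_iff {lePrem : F → F → Prop} {link : LinkPrinciple} {X Y : Argument F}
    (hX : (logicSystem Cn contrary h).IsArgument P X)
    (hY : (logicSystem Cn contrary h).IsArgument P Y) :
    (logicCSAF Cn contrary h P lePrem link).Defeats X Y ↔
      ∃ φ ∈ Y.prem, X.conc ∈ contrary φ ∧ ¬ EliLT lePrem X.prem {φ} := by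
  have hlt : ∀ φ ∈ Y.prem, ((logicCSAF Cn contrary h P lePrem link).lt X (.premise φ) ↔
      EliLT lePrem X.prem {φ}) := fun φ hφ =>
    logicCSAF_lt_iff hX (Y := .premise φ) (prem_subset_of_isArgument hY hφ)
  -- Symmetry of contrariness leaves no proper contraries, so preferences matter for every attack.
  have hind : ∀ B, ¬ (logicCSAF Cn contrary h P lePrem link).PrefIndependentAttacksOn X Y B := by
    rintro B (⟨_, r, _⟩ | ⟨hB, n, C, φ, rfl, _⟩ | ⟨φ, _, _, hc⟩)
    · exact r.2.elim
    · exact defeasible_notMem_sub hY hB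
    · exact hc.2 (h.symm _ _ hc.1)
  constructor
  · rintro ⟨B, hB | ⟨⟨⟨_, r, _⟩ | ⟨hB, n, C, φ, rfl, _⟩ | ⟨φ, rfl, hφ, hc⟩, _⟩, hnlt⟩⟩
    · exact (hind B hB).elim
    · exact r.2.elim
    · exact (defeasible_notMem_sub hY hB).elim
    · exact ⟨φ, hφ.1, hc, fun he => hnlt ((hlt φ hφ.1).2 he)⟩
  · rintro ⟨φ, hφ, hc, hn⟩
    exact ⟨.premise φ, Or.inr ⟨⟨Or.inr (Or.inr ⟨φ, rfl,
      ⟨hφ, prem_subset_of_isArgument hY hφ⟩, hc⟩), hind _⟩, fun he => hn ((hlt φ hφ).1 he)⟩⟩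

/-- One strict rule applied to the members of a finite set of premises. -/
theorem exists_isArgument_of_mem_Cn {T : Finset F} (hT : (T : Set F) ⊆ P) {ψ : F}
    (hψ : ψ ∈ Cn T) :
    ∃ A : Argument F, (logicSystem Cn contrary h).IsArgument P A ∧ A.prem = T ∧ A.conc = ψ := by
  refine ⟨.strict T.toList.length (fun i => .premise (T.toList.get i)) ψ,
    ⟨fun i => hT (Finset.mem_toList.1 (List.get_mem _ i)), ?_⟩, ?_, rfl⟩
  · have hT' : {φ | φ ∈ List.ofFn fun i => T.toList.get i} = (T : Set F) := by
      ext φ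
      rw [mem_ofPred_eq, List.ofFn_get, Finset.mem_toList, Finset.mem_coe]
    exact (congrArg (ψ ∈ Cn ·) hT').mpr hψ
  · ext φ
    simp only [Argument.prem, mem_iUnion, mem_singleton_iff, Finset.mem_coe]
    rw [← Finset.mem_toList, List.mem_iff_get]
    exact exists_congr fun i => eq_comm

end Logic

/-! ### The framework of a default theory -/

section Classical

variable {L : FirstOrder.Language.{u, v}} {V : Type w}
  {contrary : L.Formula V → Set (L.Formula V)} {h : IsContrariness classicalCn contrary}

theorem conc_mem_classicalCn_prem {P : Set (L.Formula V)} {A : Argument (L.Formula V)}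
    (hA : (logicSystem classicalCn contrary h).IsArgument P A) :
    A.conc ∈ classicalCn A.prem := by
  induction A with
  | premise φ => exact mem_classicalCn_of_mem rfl
  | strict n A ψ ih =>
    refine classicalCn_trans ?_ hA.2
    intro φ hφ
    obtain ⟨i, rfl⟩ := (List.mem_ofFn' _ _).1 hφ
    exact classicalCn_mono (subset_iUnion (fun i => (A i).prem) i) (ih i (hA.1 i))
  | defeasible n A ψ ih => exact hA.2.elim

/-- A consistent set does not entail a member of the contrariness set of a formula that it
entails. -/
theorem Consistent.notMem_contrary {S : Set (L.Formula V)} (hS : Consistent classicalCn S)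
    (h : IsContrariness classicalCn contrary) {φ ψ : L.Formula V} (hφ : φ ∈ classicalCn S)
    (hψ : ψ ∈ classicalCn S) : ψ ∉ contrary φ :=
  fun hc => h.inconsistent _ _ hc
    (hS.of_subset_classicalCn (insert_subset hψ (singleton_subset_iff.2 hφ)))

/-- By soundness, everything strictly derived from `S` lies in `Cn(S)`. The converse is not needed:
arguments constructed below have consistent premises. -/
theorem Consistent.cConsistent {S : Set (L.Formula V)} (hS : Consistent classicalCn S) :
    (logicSystem classicalCn contrary h).CConsistent S := by
  rintro φ ψ hc ⟨⟨A, hA, _, rfl⟩, ⟨B, hB, _, rfl⟩⟩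
  exact hS.notMem_contrary h
    (classicalCn_mono (prem_subset_of_isArgument hA) (conc_mem_classicalCn_prem hA))
    (classicalCn_mono (prem_subset_of_isArgument hB) (conc_mem_classicalCn_prem hB)) hc.1

namespace DefaultTheory

variable {n : ℕ} {Γ : DefaultTheory L V n} {link : LinkPrinciple}

theorem eq_of_mem_stratum {i j : Fin n} {φ : L.Formula V} (hi : φ ∈ Γ.stratum i)
    (hj : φ ∈ Γ.stratum j) : i = j := by
  by_contra hij
  exact disjoint_left.1 (Γ.disjoint_strata i j hij) hi hj

theorem le_iff {i j : Fin n} {φ ψ : L.Formula V} (hi : φ ∈ Γ.stratum i) (hj : ψ ∈ Γ.stratum j) :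
    Γ.le φ ψ ↔ j ≤ i := by
  refine ⟨?_, fun hij => ⟨i, j, hi, hj, hij⟩⟩
  rintro ⟨i', j', hi', hj', hij⟩
  rwa [eq_of_mem_stratum hi hi', eq_of_mem_stratum hj hj']

/-- `S ⊀ φ` for a set `S` of defaults iff no member of `S` comes from a later stratum
than `φ`. -/
theorem not_eliLT_singleton_iff {S : Set (L.Formula V)} (hS : S ⊆ Γ.formulas) {i : Fin n}
    {φ : L.Formula V} (hφ : φ ∈ Γ.stratum i) :
    ¬ EliLT Γ.le S {φ} ↔ S ⊆ ⋃ j ≤ i, Γ.stratum j := by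
  constructor
  · intro hn x hx
    obtain ⟨j, hj⟩ := mem_iUnion.1 (hS hx)
    refine mem_iUnion₂.2 ⟨j, ?_, hj⟩
    by_contra hji
    refine hn ⟨(nonempty_of_mem hx).ne_empty, Or.inr ⟨x, hx, ?_⟩⟩
    rintro _ rfl
    rw [le_iff hj hφ, le_iff hφ hj]
    exact ⟨(not_le.1 hji).le, hji⟩
  · rintro hsub ⟨_, h0 | ⟨x, hx, hlt⟩⟩
    · exact singleton_ne_empty _ h0
    · obtain ⟨j, hji, hj⟩ := mem_iUnion₂.1 (hsub hx)
      exact (hlt φ rfl).2 ((le_iff hφ hj).2 hji)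

theorem mem_csaf_args {A : Argument (L.Formula V)}
    (hA : (logicSystem classicalCn contrary h).IsArgument Γ.formulas A)
    (hc : Consistent classicalCn A.prem) : A ∈ (Γ.csaf contrary h link).args := by
  refine ⟨?_, hc.cConsistent (h := h)⟩
  rwa [show (Γ.csaf contrary h link).kb.axioms ∪ (Γ.csaf contrary h link).kb.ordinary =
    Γ.formulas from empty_union _]

/-- A finite consistent set `T` of defaults that is inconsistent with `φ` is the premise set of
an argument against `φ`. -/
theorem exists_mem_args_conc_mem_contrary {T : Finset (L.Formula V)} {φ : L.Formula V}
    (hT : (T : Set (L.Formula V)) ⊆ Γ.formulas)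
    (hc : Consistent classicalCn (T : Set (L.Formula V)))
    (hφ : ¬ Consistent classicalCn (insert φ (T : Set (L.Formula V)))) :
    ∃ X ∈ (Γ.csaf contrary h link).args, X.prem = T ∧ X.conc ∈ contrary φ := by
  obtain ⟨ψ, hψ, hψφ⟩ := h.exists_mem_classicalCn hφ
  obtain ⟨X, hX, hprem, rfl⟩ := exists_isArgument_of_mem_Cn (h := h) hT hψ
  exact ⟨X, mem_csaf_args hX (hprem ▸ hc), hprem, hψφ⟩

theorem csaf_defeats_iff {X Y : Argument (L.Formula V)}
    (hX : X ∈ (Γ.csaf contrary h link).args) (hY : Y ∈ (Γ.csaf contrary h link).args) :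
    (Γ.csaf contrary h link).Defeats X Y ↔ ∃ i, ∃ φ ∈ Y.prem ∩ Γ.stratum i,
      X.conc ∈ contrary φ ∧ X.prem ⊆ ⋃ j ≤ i, Γ.stratum j := by
  have hX' := isArgument_of_mem_args hX
  have hY' := isArgument_of_mem_args hY
  refine (logicCSAF_defeats_iff hX' hY').trans ⟨?_, ?_⟩
  · rintro ⟨φ, hφ, hc, hn⟩
    obtain ⟨i, hi⟩ := mem_iUnion.1 (prem_subset_of_isArgument hY' hφ)
    exact ⟨i, φ, ⟨hφ, hi⟩, hc, (not_eliLT_singleton_iff (prem_subset_of_isArgument hX') hi).1 hn⟩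
  · rintro ⟨i, φ, ⟨hφ, hi⟩, hc, hs⟩
    exact ⟨φ, hφ, hc, (not_eliLT_singleton_iff (prem_subset_of_isArgument hX') hi).2 hs⟩

theorem IsPreferredSubtheory.consistent {S : Set (L.Formula V)} (hS : Γ.IsPreferredSubtheory S) :
    Consistent classicalCn S := by
  obtain ⟨P, rfl, hP⟩ := hS
  cases n with
  | zero => simpa using consistent_empty
  | succ n =>
    -- The condition at the last stratum already concerns all of `S`; without strata, `S` is empty.
    refine (hP (Fin.last n)).1.2.mono (iUnion_subset fun i => ?_)
    exact subset_iUnion₂_of_subset i (Fin.le_last i) subset_rfl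

/-- The arguments over a preferred subtheory form a stable extension. -/
theorem IsPreferredSubtheory.isStable_argsOver {S : Set (L.Formula V)}
    (hS : Γ.IsPreferredSubtheory S) :
    (Γ.csaf contrary h link).IsStable ((Γ.csaf contrary h link).argsOver S) := by
  classical
  have hcons := hS.consistent
  refine CSAF.ConflictFree.isStable ⟨fun A hA => hA.1, fun X hX Y hY hXY => ?_⟩
    fun Y hY hYS => ?_
  · obtain ⟨φ, hφ, hc⟩ := (logicCSAF_attacks_iff (isArgument_of_mem_args hY.1)).1 hXY
    exact hcons.notMem_contrary h (mem_classicalCn_of_mem (hY.2 hφ))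
      (classicalCn_mono hX.2 (conc_mem_classicalCn_prem (isArgument_of_mem_args hX.1))) hc
  · obtain ⟨P, rfl, hP⟩ := hS
    obtain ⟨φ, hφ, hφS⟩ := not_subset.1 fun hsub => hYS ⟨hY, hsub⟩
    obtain ⟨i, hi⟩ := mem_iUnion.1 (prem_subset_of_isArgument (isArgument_of_mem_args hY) hφ)
    have hPi := (hP i).1.1
    have hPS : (⋃ j ≤ i, P j) ⊆ ⋃ j, P j := iUnion₂_subset fun j _ => subset_iUnion P j
    -- By maximality at the stratum of `φ`, adding the missing `φ` destroys consistency.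
    have hincons : ¬ Consistent classicalCn (insert φ (⋃ j ≤ i, P j)) := fun hc =>
      hφS <| hPS <| (hP i).2
        ⟨insert_subset (mem_iUnion₂.2 ⟨i, le_rfl, hi⟩) hPi, hc⟩ (subset_insert _ _)
        (mem_insert _ _)
    obtain ⟨T, hT, hTc⟩ : ∃ T : Finset (L.Formula V), ↑T ⊆ insert φ (⋃ j ≤ i, P j) ∧
        ¬ Consistent classicalCn (T : Set (L.Formula V)) := by
      by_contra! hall
      exact hincons (consistent_of_finset hall)
    have hsub : ((T.erase φ : Finset _) : Set (L.Formula V)) ⊆ ⋃ j ≤ i, P j := by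
      rw [Finset.coe_erase, sdiff_singleton_subset_iff]
      exact hT
    obtain ⟨X, hX, hprem, hc⟩ := exists_mem_args_conc_mem_contrary (Γ := Γ) (h := h)
      (link := link) (T := T.erase φ) (φ := φ)
      ((hsub.trans hPi).trans (iUnion₂_subset fun j _ => subset_iUnion Γ.stratum j))
      (hcons.mono (hsub.trans hPS))
      fun hc => hTc (hc.mono (by
        rw [← Finset.coe_insert]
        exact Finset.coe_subset.2 (Finset.insert_erase_subset φ T)))
    -- The premises of `X` come from strata up to that of `φ`, so the attack on `φ` succeeds as a
    -- defeat.
    exact ⟨X, ⟨hX, hprem ▸ hsub.trans hPS⟩, (csaf_defeats_iff hX hY).2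
      ⟨i, φ, ⟨hφ, hi⟩, hc, hprem ▸ hsub.trans hPi⟩⟩

/-- The premises of a stable extension are jointly consistent. -/
theorem consistent_iUnion_prem {E : Set (Argument (L.Formula V))}
    (hE : (Γ.csaf contrary h link).IsStable E) :
    Consistent classicalCn (⋃ A ∈ E, A.prem) := by
  classical
  have hcf := hE.1.1.1.1
  have hΓ : (⋃ A ∈ E, A.prem) ⊆ Γ.formulas := iUnion₂_subset fun A hA =>
    prem_subset_of_isArgument (isArgument_of_mem_args (hcf.1 hA))
  refine consistent_of_finset fun T => ?_
  induction T using Finset.strongInduction with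
  | H T ih =>
    intro hT
    obtain rfl | hne := T.eq_empty_or_nonempty
    · simpa using consistent_empty
    by_contra hincons
    have hlevel : ∀ φ : T, ∃ i, φ.1 ∈ Γ.stratum i := fun φ => mem_iUnion.1 (hΓ (hT φ.2))
    choose level hl using hlevel
    -- With `φ` from the latest stratum occurring in `T`, the argument built from the rest of `T` is
    -- not strictly below `φ`.
    obtain ⟨⟨φ, hφT⟩, _, hmax⟩ := T.attach.exists_max_image level hne.attach
    have hsub : ((T.erase φ : Finset _) : Set (L.Formula V)) ⊆ T :=
      Finset.coe_subset.2 (T.erase_subset φ)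
    obtain ⟨X, hX, hprem, hc⟩ := exists_mem_args_conc_mem_contrary (Γ := Γ) (h := h)
      (link := link) (T := T.erase φ) (φ := φ) (hsub.trans (hT.trans hΓ))
      (ih _ (Finset.erase_ssubset hφT) (hsub.trans hT))
      (by rwa [← Finset.coe_insert, Finset.insert_erase hφT])
    obtain ⟨A, hA, hφA⟩ := mem_iUnion₂.1 (hT hφT)
    have hXA : (Γ.csaf contrary h link).Defeats X A :=
      (csaf_defeats_iff hX (hcf.1 hA)).2 ⟨_, φ, ⟨hφA, hl ⟨φ, hφT⟩⟩, hc, fun x hx =>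
        mem_iUnion₂.2 ⟨_, hmax ⟨x, hsub (hprem ▸ hx)⟩ (Finset.mem_attach _ _), hl _⟩⟩
    -- Acceptability of `A` supplies `Z ∈ E` against a premise of `X`. That premise also belongs to
    -- some `B ∈ E`, so `Z` attacks `B`.
    obtain ⟨Z, hZ, hZX⟩ := hE.1.1.1.2 A hA X hX hXA
    obtain ⟨i, ψ, hψ, hZψ, _⟩ := (csaf_defeats_iff (hcf.1 hZ) hX).1 hZX
    obtain ⟨B, hB, hψB⟩ := mem_iUnion₂.1 (hT (hsub (hprem ▸ hψ.1)))
    exact hcf.2 Z hZ B hB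
      ((logicCSAF_attacks_iff (isArgument_of_mem_args (hcf.1 hB))).2 ⟨ψ, hψB, hZψ⟩)

/-- The premises of a stable extension form a preferred subtheory. -/
theorem isPreferredSubtheory_iUnion_prem {E : Set (Argument (L.Formula V))}
    (hE : (Γ.csaf contrary h link).IsStable E) :
    Γ.IsPreferredSubtheory (⋃ A ∈ E, A.prem) := by
  have hcf := hE.1.1.1.1
  have hcons := consistent_iUnion_prem hE
  have hΓ : (⋃ A ∈ E, A.prem) ⊆ Γ.formulas := iUnion₂_subset fun A hA =>
    prem_subset_of_isArgument (isArgument_of_mem_args (hcf.1 hA))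
  refine ⟨fun i => (⋃ A ∈ E, A.prem) ∩ Γ.stratum i, ?_, fun i => ?_⟩
  · rw [← inter_iUnion]
    exact (inter_eq_left.2 hΓ).symm
  have hi : (⋃ j ≤ i, (⋃ A ∈ E, A.prem) ∩ Γ.stratum j) =
      (⋃ A ∈ E, A.prem) ∩ ⋃ j ≤ i, Γ.stratum j := by
    simp only [inter_iUnion]
  rw [hi]
  refine ⟨⟨inter_subset_right, hcons.mono inter_subset_left⟩, ?_⟩
  rintro T ⟨hT, hTc⟩ hsub φ hφ
  refine ⟨?_, hT hφ⟩
  by_contra hφE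
  obtain ⟨j, hji, hj⟩ := mem_iUnion₂.1 (hT hφ)
  have harg : Argument.premise φ ∈ (Γ.csaf contrary h link).args :=
    mem_csaf_args (A := .premise φ) (mem_iUnion.2 ⟨j, hj⟩)
      (hTc.mono (singleton_subset_iff.2 hφ))
  -- Only here is it used that `E` defeats every outsider.
  obtain ⟨X, hX, hdef⟩ := hE.2 _ harg fun hmem => hφE (mem_iUnion₂.2 ⟨_, hmem, rfl⟩)
  obtain ⟨k, ψ, ⟨rfl, hk⟩, hc, hXk⟩ := (csaf_defeats_iff (hcf.1 hX) harg).1 hdef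
  obtain rfl := eq_of_mem_stratum hj hk
  -- The premises of `X` lie in strata up to that of `φ`, hence up to `i`, and so in `T`. Thus `T`
  -- entails both `φ` and a member of its contrariness set.
  refine hTc.notMem_contrary h (mem_classicalCn_of_mem hφ) (classicalCn_mono ?_
    (conc_mem_classicalCn_prem (isArgument_of_mem_args (hcf.1 hX)))) hc
  refine fun x hx => hsub ⟨mem_iUnion₂.2 ⟨X, hX, hx⟩, ?_⟩
  obtain ⟨m, hm, hxm⟩ := mem_iUnion₂.1 (hXk hx)
  exact mem_iUnion₂.2 ⟨m, hm.trans hji, hxm⟩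

end DefaultTheory

end Classical

end ASPIC

theorem mainTheorem1 {L : FirstOrder.Language.{u, v}} {V : Type w} {n : ℕ}
    (Γ : ASPIC.DefaultTheory L V n)
    (contrary : L.Formula V → Set (L.Formula V))
    (hcontrary : ASPIC.IsContrariness ASPIC.classicalCn contrary)
    (link : ASPIC.LinkPrinciple) :
    (∀ S : Set (L.Formula V), Γ.IsPreferredSubtheory S →
      (Γ.csaf contrary hcontrary link).IsStable
        ((Γ.csaf contrary hcontrary link).argsOver S)) ∧
    (∀ E : Set (ASPIC.Argument (L.Formula V)),
      (Γ.csaf contrary hcontrary link).IsStable E →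
        Γ.IsPreferredSubtheory (⋃ A ∈ E, A.prem)) :=
  ⟨fun _ hS => hS.isStable_argsOver,
    fun _ hE => ASPIC.DefaultTheory.isPreferredSubtheory_iUnion_prem hE⟩
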